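/- Let $I>J=R\ge 2$ be integers. For an array $\mathcal{Y}\in\mathbb{R}^{I\times J\times 2}$ with frontal slices $\mathbf{Y}_1,\mathbf{Y}_2\in\mathbb{R}^{I\times J}$, let $\|\mathcal{Y}\|_F$ be the Frobenius norm and let $\mathrm{rank}(\mathcal{Y})$ be the smallest number of rank-1 arrays (outer products $\mathbf{a}\circ\mathbf{b}\circ\mathbf{c}$ of nonzero real vectors) whose sum is $\mathcal{Y}$; the same definition is used for $R\times R\times 2$ arrays. Put $$W_R(I,J,2)=\{\mathcal{Y}\in\mathbb{R}^{I\times J\times 2}:\ \mathrm{rank}([\mathbf{Y}_1\,|\,\mathbf{Y}_2])\le R\},$$ where $[\mathbf{Y}_1\,|\,\mathbf{Y}_2]$ is the $I\times 2J$ matrix formed by the two slices. The GSD problem for $\mathcal{Z}$ is to minimize $$\sum_{k=1}^2\|\mathbf{Z}_k-\mathbf{Q}_a\mathbf{R}_k\mathbf{Q}_b^T\|_F^2$$ over $\mathbf{Q}_a\in\mathbb{R}^{I\times R}$ and $\mathbf{Q}_b\in\mathbb{R}^{J\times R}$ with $\mathbf{Q}_a^T\mathbf{Q}_a=\mathbf{Q}_b^T\mathbf{Q}_b=\mathbf{I}_R$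 and upper triangular $\mathbf{R}_1,\mathbf{R}_2\in\mathbb{R}^{R\times R}$. Then for a generic $\mathcal{Z}\in\mathbb{R}^{I\times J\times 2}$ (that is, for all $\mathcal{Z}$ outside a set of Lebesgue measure zero) the problem $\min_{\mathcal{Y}\in W_R(I,J,2)}\|\mathcal{Z}-\mathcal{Y}\|_F^2$ has a unique optimal solution $\mathcal{X}$, and the following holds. Let $(\mathbf{Q}_a,\mathbf{Q}_b,\mathbf{R}_1,\mathbf{R}_2)$ be any optimal solution of the GSD problem for which, with $\tilde{\mathbf{z}}_{(m,n)}=\big((\mathbf{Q}_a^T\mathbf{Z}_1\mathbf{Q}_b)_{mn},(\mathbf{Q}_a^T\mathbf{Z}_2\mathbf{Q}_b)_{mn}\big)^T\in\mathbb{R}^2$, the second-order conditions are strictly positive: $$\sum_{r=i}^{j-1}\|\tilde{\mathbf{z}}_{(i,r)}\|^2-\sum_{r=i}^{j-1}\|\tilde{\mathbf{z}}_{(j,r)}\|^2>0 \quad\text{and}\quad \sum_{r=i+1}^{j}\|\tilde{\mathbf{z}}_{(r,j)}\|^2-\sum_{r=i+1}^{j}\|\tilde{\mathbf{z}}_{(r,i)}\|^2>0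 \qquad(1\le i<j\le R).$$ If $\mathrm{rank}(\mathcal{X})>R$, then the $R\times R\times 2$ array $\mathcal{R}$ with slices $\mathbf{R}_1$ and $\mathbf{R}_2$ satisfies $\mathrm{rank}(\mathcal{R})>R$. -/

import Mathlib

open MeasureTheory
open scoped Matrix

/-- Real three-way arrays of size `I × J × K`; `Y i j k` is the entry in row `i` and column `j`
of the `k`-th frontal slice. -/
abbrev ThreeWay (I J K : ℕ) : Type := Fin I → Fin J → Fin K → ℝ

namespace ThreeWay

/-- The `k`-th frontal slice. -/
def slice {I J K : ℕ} (Y : ThreeWay I J K) (k : Fin K) : Matrix (Fin I) (Fin J) ℝ :=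
  Matrix.of fun i j => Y i j k

/-- The array with prescribed frontal slices. -/
def ofSlices {I J K : ℕ} (M : Fin K → Matrix (Fin I) (Fin J) ℝ) : ThreeWay I J K :=
  fun i j k => M k i j

/-- Rank-one arrays: outer products of three nonzero vectors. -/
def IsRankOne {I J K : ℕ} (Y : ThreeWay I J K) : Prop :=
  ∃ (a : Fin I → ℝ) (b : Fin J → ℝ) (c : Fin K → ℝ),
    a ≠ 0 ∧ b ≠ 0 ∧ c ≠ 0 ∧ ∀ i j k, Y i j k = a i * b j * c k

/-- `Y` is a sum of exactly `n` rank-one arrays. -/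
def IsSumOfRankOnes {I J K : ℕ} (n : ℕ) (Y : ThreeWay I J K) : Prop :=
  ∃ T : Fin n → ThreeWay I J K, (∀ r, IsRankOne (T r)) ∧ Y = ∑ r, T r

/-- The rank of a three-way array: the smallest number of rank-one arrays whose sum is the
array. -/
noncomputable def rank {I J K : ℕ} (Y : ThreeWay I J K) : ℕ :=
  sInf {n : ℕ | IsSumOfRankOnes n Y}

/-- Every array is a finite sum of rank-one arrays, so the infimum in `rank` is attained. -/
theorem isSumOfRankOnes_rank {I J K : ℕ} (Y : ThreeWay I J K) :
    IsSumOfRankOnes (rank Y) Y := by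
  classical
  have zero : IsSumOfRankOnes 0 (0 : ThreeWay I J K) := ⟨fun r => r.elim0, fun r => r.elim0, by simp⟩
  have add : ∀ A B : ThreeWay I J K, (∃ n, IsSumOfRankOnes n A) → (∃ n, IsSumOfRankOnes n B) →
      ∃ n, IsSumOfRankOnes n (A + B) := by
    rintro A B ⟨m, S, hS, rfl⟩ ⟨n, T, hT, rfl⟩
    refine ⟨m + n, Fin.append S T, fun r => ?_, ?_⟩
    · refine Fin.addCases (fun i => ?_) (fun i => ?_) r
      · simpa using hS i
      · simpa using hT i
    · simp [Fin.sum_univ_add]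
  have sum : ∀ {ι : Type} (s : Finset ι) (f : ι → ThreeWay I J K),
      (∀ x ∈ s, ∃ n, IsSumOfRankOnes n (f x)) → ∃ n, IsSumOfRankOnes n (∑ x ∈ s, f x) := by
    intro ι s f h
    exact Finset.sum_induction f (fun A => ∃ n, IsSumOfRankOnes n A) add ⟨0, zero⟩ h
  have single : ∀ (p : Fin I × Fin J × Fin K), ∃ n, IsSumOfRankOnes n
      ((fun i j k => if (i, j, k) = p then Y i j k else 0) : ThreeWay I J K) := by
    rintro ⟨i₀, j₀, k₀⟩
    by_cases hy : Y i₀ j₀ k₀ = 0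
    · refine ⟨0, ?_⟩
      convert zero using 1
      funext i j k
      simp only [Prod.mk.injEq, Pi.zero_apply]
      split_ifs with h
      · obtain ⟨rfl, rfl, rfl⟩ := h
        exact hy
      · rfl
    · refine ⟨1, fun _ => _, fun _ => ⟨Pi.single i₀ (Y i₀ j₀ k₀), Pi.single j₀ 1, Pi.single k₀ 1,
        by simpa using hy, by simp, by simp, fun i j k => ?_⟩, by simp; rfl⟩
      by_cases h1 : i = i₀ <;> by_cases h2 : j = j₀ <;> by_cases h3 : k = k₀ <;>
        simp [h1, h2, h3]
  have hne : {n : ℕ | IsSumOfRankOnes n Y}.Nonempty := by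
    have hY : Y = ∑ p : Fin I × Fin J × Fin K,
        ((fun i j k => if (i, j, k) = p then Y i j k else 0) : ThreeWay I J K) := by
      funext i j k
      simp [Finset.sum_apply]
    rw [hY]
    exact sum Finset.univ _ (fun p _ => single p)
  exact Nat.sInf_mem hne

/-- The squared Frobenius norm. -/
def frobSq {I J K : ℕ} (Y : ThreeWay I J K) : ℝ := ∑ i, ∑ j, ∑ k, Y i j k ^ 2

/-- The set `W_R(I,J,2)`: the arrays for which the `I × 2J` matrix `[Y₁ | Y₂]` has rank at
most `R`. -/
def W (I J R : ℕ) : Set (ThreeWay I J 2) :=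
  {Y | (Matrix.fromCols (Y.slice 0) (Y.slice 1)).rank ≤ R}

/-- `X` is an optimal solution of `min {‖Z - Y‖²_F : Y ∈ W_R(I,J,2)}`. -/
def IsBestFromW {I J : ℕ} (R : ℕ) (Z X : ThreeWay I J 2) : Prop :=
  X ∈ W I J R ∧ ∀ Y ∈ W I J R, frobSq (Z - X) ≤ frobSq (Z - Y)

end ThreeWay

/-- Candidate generalized Schur decompositions: `Q_a`, `Q_b` and the matrices `R_1`, `R_2`
(which are `Rm 0`, `Rm 1`). -/
structure GSD (I J R : ℕ) where
  Qa : Matrix (Fin I) (Fin R) ℝ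
  Qb : Matrix (Fin J) (Fin R) ℝ
  Rm : Fin 2 → Matrix (Fin R) (Fin R) ℝ

namespace GSD

/-- The constraints: `Q_a`, `Q_b` columnwise orthonormal, `R_1`, `R_2` upper triangular. -/
def Feasible {I J R : ℕ} (G : GSD I J R) : Prop :=
  G.Qaᵀ * G.Qa = 1 ∧ G.Qbᵀ * G.Qb = 1 ∧ ∀ k, (G.Rm k).BlockTriangular id

/-- The array with slices `Q_a R_k Q_bᵀ`. -/
def toArray {I J R : ℕ} (G : GSD I J R) : ThreeWay I J 2 :=
  ThreeWay.ofSlices fun k => G.Qa * G.Rm k * G.Qbᵀ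

/-- Optimal solutions of the problem of minimizing `∑ₖ ‖Z_k - Q_a R_k Q_bᵀ‖²_F` subject to the
constraints. -/
def IsOptimal {I J R : ℕ} (Z : ThreeWay I J 2) (G : GSD I J R) : Prop :=
  G.Feasible ∧ ∀ G' : GSD I J R, G'.Feasible →
    ThreeWay.frobSq (Z - G.toArray) ≤ ThreeWay.frobSq (Z - G'.toArray)

/-- The squared length of the vector `((Q_aᵀ Z_1 Q_b)_{mn}, (Q_aᵀ Z_2 Q_b)_{mn})`. -/
noncomputable def tildeSq {I J R : ℕ} (Z : ThreeWay I J 2) (G : GSD I J R) (m n : Fin R) : ℝ :=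
  ∑ k : Fin 2, ((G.Qaᵀ * Z.slice k * G.Qb) m n) ^ 2

/-- The second-order conditions for the Givens rotations of rows `i < j` and of columns `i < j`
hold with strict inequality. -/
def StrictSecondOrder {I J R : ℕ} (Z : ThreeWay I J 2) (G : GSD I J R) : Prop :=
  ∀ i j : Fin R, i < j →
    0 < ∑ r ∈ Finset.Ico i j, tildeSq Z G i r - ∑ r ∈ Finset.Ico i j, tildeSq Z G j r ∧
    0 < ∑ r ∈ Finset.Ioc i j, tildeSq Z G r j - ∑ r ∈ Finset.Ioc i j, tildeSq Z G r i

end GSD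

/-!
If the core of an optimal GSD has rank at most `R` and no diagonal position vanishes in both slices,
its pencil is regular, so `V = [R₁Q_bᵀ | R₂Q_bᵀ]` has slices `A D_k B` with `A`, `B` invertible.
At such a `V` every rank-one direction `x wᵀ` is tangent to second order to the set of pencils with
a Schur form: choose the decomposition so that `x` is a combination of columns of `A` with
pairwise non-parallel third factors; row and column operations then absorb the perturbation up to
a part that is triangular after a permutation. Hence `(Q_a, V)` meets the first- and second-order
conditions for approximating the `I × 2R` matrix `[Z₁ | Z₂]` by matrices of rank at most `R`, where
these conditions already force a global minimum. For almost every `Z` that minimum is unique, since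
the distance function to a closed set is differentiable almost everywhere. So the GSD array is `X`,
and its rank is at most that of the core.
-/

section NearestPoint

open Filter Topology

theorem eq_zero_of_eventually_nonneg_id_mul {f : ℝ → ℝ} (hf : ContinuousAt f 0)
    (h : ∀ᶠ t in 𝓝 0, 0 ≤ t * f t) : f 0 = 0 := by
  refine le_antisymm (le_of_tendsto (hf.tendsto.mono_left (nhdsWithin_le_nhds (s := Set.Iio 0))) ?_)
    (ge_of_tendsto (hf.tendsto.mono_left (nhdsWithin_le_nhds (s := Set.Ioi 0))) ?_)
  · filter_upwards [h.filter_mono nhdsWithin_le_nhds, self_mem_nhdsWithin] with t ht ht0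
    exact nonpos_of_mul_nonneg_right ht ht0
  · filter_upwards [h.filter_mono nhdsWithin_le_nhds, self_mem_nhdsWithin] with t ht ht0
    exact nonneg_of_mul_nonneg_right ht ht0

theorem nonneg_of_eventually_nonneg_sq_mul {f : ℝ → ℝ} (hf : ContinuousAt f 0)
    (h : ∀ᶠ t in 𝓝 0, 0 ≤ t ^ 2 * f t) : 0 ≤ f 0 := by
  refine ge_of_tendsto (hf.tendsto.mono_left (nhdsWithin_le_nhds (s := {0}ᶜ))) ?_
  filter_upwards [h.filter_mono nhdsWithin_le_nhds, self_mem_nhdsWithin] with t ht ht0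
  exact nonneg_of_mul_nonneg_right ht (pow_pos (abs_pos.2 ht0) 2 |>.trans_eq (sq_abs t))

theorem norm_sub_curve_sq {E : Type*} [NormedAddCommGroup E] [InnerProductSpace ℝ E] (x p : E)
    (q : ℝ → E) (t : ℝ) :
    ‖x - (t • p + t ^ 2 • q t)‖ ^ 2 = ‖x‖ ^ 2 + t * (-2 * inner ℝ x p + t *
      (‖p‖ ^ 2 - 2 * inner ℝ x (q t) + t * (2 * inner ℝ p (q t) + t * ‖q t‖ ^ 2))) := by
  rw [norm_sub_sq_real, norm_add_sq_real, inner_add_right]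
  simp only [inner_smul_left, inner_smul_right, norm_smul, mul_pow, Real.norm_eq_abs, sq_abs,
    abs_pow, conj_trivial]
  ring

/-- `y` is a point of `s` at least distance from `x`. -/
def IsNearestPoint {E : Type*} [Dist E] (s : Set E) (x y : E) : Prop :=
  y ∈ s ∧ ∀ z ∈ s, dist x y ≤ dist x z

namespace IsNearestPoint

theorem infDist_eq {E : Type*} [PseudoMetricSpace E] {s : Set E} {x y : E}
    (h : IsNearestPoint s x y) : Metric.infDist x s = dist x y :=
  le_antisymm (Metric.infDist_le_dist_of_mem h.1) ((Metric.le_infDist ⟨y, h.1⟩).2 @h.2)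

variable {E : Type*} [NormedAddCommGroup E] [InnerProductSpace ℝ E] {s : Set E}
  {x y y' p : E} {q : ℝ → E}

theorem inner_eq_zero (h : IsNearestPoint s x y) (hq : ContinuousAt q 0)
    (hs : ∀ᶠ t in 𝓝 0, y + (t • p + t ^ 2 • q t) ∈ s) : inner ℝ (x - y) p = 0 := by
  have hzero := eq_zero_of_eventually_nonneg_id_mul (f := fun t => -2 * inner ℝ (x - y) p + t *
    (‖p‖ ^ 2 - 2 * inner ℝ (x - y) (q t) + t * (2 * inner ℝ p (q t) + t * ‖q t‖ ^ 2)))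
    (by fun_prop) <| by
      filter_upwards [hs] with t ht
      have hle := pow_le_pow_left₀ dist_nonneg (h.2 _ ht) 2
      rw [dist_eq_norm, dist_eq_norm, ← sub_sub, norm_sub_curve_sq (x - y)] at hle
      linarith
  simpa using hzero

theorem two_mul_inner_le (h : IsNearestPoint s x y) (hq : ContinuousAt q 0)
    (hs : ∀ᶠ t in 𝓝 0, y + (t • p + t ^ 2 • q t) ∈ s) :
    2 * inner ℝ (x - y) (q 0) ≤ ‖p‖ ^ 2 := by
  have hnonneg := nonneg_of_eventually_nonneg_sq_mul (f := fun t =>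
    ‖p‖ ^ 2 - 2 * inner ℝ (x - y) (q t) + t * (2 * inner ℝ p (q t) + t * ‖q t‖ ^ 2))
    (by fun_prop) <| by
      filter_upwards [hs] with t ht
      have hle := pow_le_pow_left₀ dist_nonneg (h.2 _ ht) 2
      rw [dist_eq_norm, dist_eq_norm, ← sub_sub, norm_sub_curve_sq (x - y),
        h.inner_eq_zero hq hs] at hle
      linarith
  simpa using hnonneg

theorem fderiv_infDist_sq_eq (h : IsNearestPoint s x y)
    (hd : DifferentiableAt ℝ (Metric.infDist · s) x) :
    fderiv ℝ (fun z => Metric.infDist z s ^ 2) x = 2 • innerSL ℝ (x - y) := by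
  have hdist : HasFDerivAt (fun z => ‖z - y‖ ^ 2) (2 • innerSL ℝ (x - y)) x := by
    simpa using ((hasFDerivAt_id x).sub_const y).norm_sq
  have hmin : IsLocalMin (fun z => ‖z - y‖ ^ 2 - Metric.infDist z s ^ 2) x := by
    refine Filter.Eventually.of_forall fun z => ?_
    have hz : Metric.infDist z s ≤ ‖z - y‖ :=
      (Metric.infDist_le_dist_of_mem h.1).trans_eq (dist_eq_norm z y)
    have hsq := pow_le_pow_left₀ Metric.infDist_nonneg hz 2
    simpa [h.infDist_eq, dist_eq_norm] using hsq
  exact (sub_eq_zero.1 (hmin.hasFDerivAt_eq_zero (hdist.sub (hd.pow 2).hasFDerivAt))).symm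

theorem unique_of_differentiableAt (h : IsNearestPoint s x y) (h' : IsNearestPoint s x y')
    (hd : DifferentiableAt ℝ (Metric.infDist · s) x) : y = y' := by
  have heq := (h.fderiv_infDist_sq_eq hd).symm.trans (h'.fderiv_infDist_sq_eq hd)
  have hinner : innerSL ℝ (x - y) = innerSL ℝ (x - y') := by
    ext z
    simpa using DFunLike.congr_fun heq z
  exact sub_right_injective (innerSL_inj.1 hinner)

end IsNearestPoint

theorem ae_existsUnique_isNearestPoint {E : Type*} [NormedAddCommGroup E] [InnerProductSpace ℝ E]
    [FiniteDimensional ℝ E] [MeasurableSpace E] [BorelSpace E] (μ : Measure E) [μ.IsAddHaarMeasure]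
    {s : Set E} (hs : IsClosed s) (hne : s.Nonempty) : ∀ᵐ x ∂μ, ∃! y, IsNearestPoint s x y := by
  filter_upwards [(Metric.lipschitz_infDist_pt s).ae_differentiableAt] with x hx
  obtain ⟨y, hy, hxy⟩ := hs.exists_infDist_eq_dist hne x
  have hnear : IsNearestPoint s x y := ⟨hy, fun z hz => hxy ▸ Metric.infDist_le_dist_of_mem hz⟩
  exact ⟨y, hnear, fun y' hy' => hy'.unique_of_differentiableAt hnear hx⟩

theorem ae_existsUnique_isNearestPoint_map {F E : Type*} [NormedAddCommGroup F] [NormedSpace ℝ F]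
    [FiniteDimensional ℝ F] [MeasurableSpace F] [BorelSpace F] [NormedAddCommGroup E]
    [InnerProductSpace ℝ E] (μ : Measure F) [μ.IsAddHaarMeasure] (e : F ≃ₗ[ℝ] E) {s : Set E}
    (hs : IsClosed s) (hne : s.Nonempty) : ∀ᵐ x ∂μ, ∃! y, IsNearestPoint s (e x) y := by
  have := e.finiteDimensional
  borelize E
  have hμ := e.toContinuousLinearEquiv.isAddHaarMeasure_map μ
  exact ae_of_ae_map e.toContinuousLinearEquiv.continuous.measurable.aemeasurable
    (ae_existsUnique_isNearestPoint _ hs hne)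

end NearestPoint

theorem isClosed_setOf_rank_le {m n : Type*} [Finite m] [Fintype n] (r : ℕ) :
    IsClosed {X : Matrix m n ℝ | X.rank ≤ r} := by
  classical
  have := Fintype.ofFinite m
  have hopen := (isOpen_setOfPred_nat_le_rank (𝕜 := ℝ) (E := n → ℝ) (F := m → ℝ) (r + 1)).preimage
    (LinearMap.toContinuousLinearMap.toLinearMap ∘ₗ
      (Matrix.toLin' (R := ℝ)).toLinearMap).continuous_of_finiteDimensional
  rw [← isOpen_compl_iff]
  convert! hopen using 1
  ext X
  change ¬ X.rank ≤ r ↔ ((r + 1 : ℕ) : Cardinal) ≤ Module.rank ℝ (Matrix.mulVecLin X).range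
  rw [← Module.finrank_eq_rank, Nat.cast_le]
  exact not_le

section Frobenius

open scoped Matrix.Norms.Frobenius

variable {m n p : Type*} [Fintype m] [Fintype n] [Fintype p]

theorem frobenius_norm_sq (X : Matrix m n ℝ) : ‖X‖ ^ 2 = (Xᵀ * X).trace := by
  rw [Matrix.frobenius_norm_def, ← Real.sqrt_eq_rpow, Real.sq_sqrt (by positivity),
    Finset.sum_comm]
  simp [Matrix.trace, Matrix.mul_apply, pow_two]

/-- The trace inner product `⟪X, Y⟫ = tr (Xᵀ Y)`, compatible with the Frobenius norm. It is only
a local instance because matrices carry several natural norms. -/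
@[reducible, local instance]
noncomputable def frobeniusInnerProductSpace : InnerProductSpace ℝ (Matrix m n ℝ) where
  inner X Y := (Xᵀ * Y).trace
  norm_sq_eq_re_inner X := frobenius_norm_sq X
  conj_inner_symm X Y := by simp [← Matrix.trace_transpose (Xᵀ * Y)]
  add_left X Y T := by simp [Matrix.add_mul]
  smul_left X Y c := by simp

theorem frobenius_inner_def (X Y : Matrix m n ℝ) : inner ℝ X Y = (Xᵀ * Y).trace := rfl

theorem frobenius_inner_mul_left (X : Matrix m n ℝ) (A : Matrix m p ℝ) (V : Matrix p n ℝ) :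
    inner ℝ X (A * V) = inner ℝ (Aᵀ * X) V := by
  simp [frobenius_inner_def, Matrix.mul_assoc]

theorem frobenius_inner_mul_right (X : Matrix m n ℝ) (A : Matrix m p ℝ) (V : Matrix p n ℝ) :
    inner ℝ X (A * V) = inner ℝ (X * Vᵀ) A := by
  rw [frobenius_inner_def, frobenius_inner_def, ← Matrix.mul_assoc, Matrix.trace_mul_comm,
    Matrix.transpose_mul, Matrix.transpose_transpose, Matrix.mul_assoc]

theorem frobenius_inner_vecMulVec (X : Matrix m n ℝ) (u : m → ℝ) (v : n → ℝ) :
    inner ℝ X (Matrix.vecMulVec u v) = u ⬝ᵥ X *ᵥ v := by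
  rw [frobenius_inner_def, Matrix.mul_vecMulVec, Matrix.trace_vecMulVec, Matrix.mulVec_transpose,
    Matrix.dotProduct_mulVec]

theorem frobenius_inner_single [DecidableEq m] [DecidableEq n] (X : Matrix m n ℝ) (i : m) (j : n) :
    inner ℝ X (Matrix.single i j 1) = X i j := by
  simp [frobenius_inner_def, Matrix.trace_mul_single]

theorem frobenius_norm_vecMulVec_sq (u : m → ℝ) (v : n → ℝ) :
    ‖Matrix.vecMulVec u v‖ ^ 2 = (u ⬝ᵥ u) * (v ⬝ᵥ v) := by
  rw [← real_inner_self_eq_norm_sq, frobenius_inner_vecMulVec, Matrix.vecMulVec_mulVec]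
  simp [mul_comm]

theorem frobenius_norm_sq_eq_sum_dotProduct (X : Matrix m n ℝ) : ‖X‖ ^ 2 = ∑ i, X i ⬝ᵥ X i := by
  rw [← Matrix.frobenius_norm_transpose, frobenius_norm_sq]
  simp [Matrix.trace, Matrix.mul_apply, dotProduct]

section Projection

variable [DecidableEq p] {C : Matrix m p ℝ}

theorem frobenius_norm_mul_sq_of_transpose_mul_self_eq_one (hC : Cᵀ * C = 1) (X : Matrix p n ℝ) :
    ‖C * X‖ ^ 2 = ‖X‖ ^ 2 := by
  rw [← real_inner_self_eq_norm_sq, frobenius_inner_mul_left, ← Matrix.mul_assoc, hC,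
    Matrix.one_mul, real_inner_self_eq_norm_sq]

theorem frobenius_inner_sub_projection_mul (hC : Cᵀ * C = 1) (X : Matrix m n ℝ)
    (V : Matrix p n ℝ) : inner ℝ (X - C * (Cᵀ * X)) (C * V) = 0 := by
  rw [frobenius_inner_mul_left, Matrix.mul_sub, ← Matrix.mul_assoc, hC, Matrix.one_mul, sub_self,
    inner_zero_left]

theorem frobenius_norm_sub_mul_sq (hC : Cᵀ * C = 1) (X : Matrix m n ℝ) (V : Matrix p n ℝ) :
    ‖X - C * V‖ ^ 2 = ‖X - C * (Cᵀ * X)‖ ^ 2 + ‖Cᵀ * X - V‖ ^ 2 := by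
  have hsplit : X - C * V = X - C * (Cᵀ * X) + C * (Cᵀ * X - V) := by
    rw [Matrix.mul_sub]
    abel
  rw [hsplit, norm_add_sq_real, frobenius_inner_sub_projection_mul hC,
    frobenius_norm_mul_sq_of_transpose_mul_self_eq_one hC]
  ring

theorem frobenius_norm_sub_projection_sq (hC : Cᵀ * C = 1) (X : Matrix m n ℝ) :
    ‖X - C * (Cᵀ * X)‖ ^ 2 = ‖X‖ ^ 2 - ‖Cᵀ * X‖ ^ 2 := by
  simpa [eq_sub_iff_add_eq, eq_comm] using frobenius_norm_sub_mul_sq hC X 0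

end Projection

end Frobenius

section Factorization

theorem exists_mul_eq_of_rank_le {𝕜 m n : Type*} [Field 𝕜] [Finite m] [Fintype n] {R : ℕ}
    {M : Matrix m n 𝕜} (h : M.rank ≤ R) :
    ∃ (A : Matrix m (Fin R) 𝕜) (V : Matrix (Fin R) n 𝕜), M = A * V := by
  classical
  have hfinrank : Module.finrank 𝕜 M.mulVecLin.range ≤ Module.finrank 𝕜 (Fin R → 𝕜) := by
    simpa [Matrix.rank] using h
  obtain ⟨f, hf⟩ := finrank_le_iff_exists_linearMap.1 hfinrank
  obtain ⟨g, hgf⟩ := f.exists_leftInverse_of_injective (LinearMap.ker_eq_bot.2 hf)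
  refine ⟨(M.mulVecLin.range.subtype ∘ₗ g).toMatrix',
    (f ∘ₗ M.mulVecLin.rangeRestrict).toMatrix', ?_⟩
  have hcomp : (M.mulVecLin.range.subtype ∘ₗ g) ∘ₗ f ∘ₗ M.mulVecLin.rangeRestrict =
      M.mulVecLin := by
    rw [LinearMap.comp_assoc, ← LinearMap.comp_assoc _ f g, hgf, LinearMap.id_comp,
      LinearMap.subtype_comp_codRestrict]
  rw [← LinearMap.toMatrix'_comp, hcomp]
  exact (LinearMap.toMatrix'_toLin' M).symm

theorem transpose_mul_self_eq_one_of_orthonormal {m ι : Type*} [Fintype m] [DecidableEq ι]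
    {v : ι → EuclideanSpace ℝ m} (hv : Orthonormal ℝ v) :
    (Matrix.of fun i r => v r i)ᵀ * (Matrix.of fun i r => v r i) = 1 := by
  ext r s
  rw [Matrix.one_apply, ← orthonormal_iff_ite.1 hv r s]
  simp [Matrix.mul_apply, PiLp.inner_apply, mul_comm]

theorem exists_qr {m : Type*} [Fintype m] {R : ℕ} (hR : R ≤ Fintype.card m)
    (A : Matrix m (Fin R) ℝ) :
    ∃ (Q : Matrix m (Fin R) ℝ) (T : Matrix (Fin R) (Fin R) ℝ),
      Qᵀ * Q = 1 ∧ T.BlockTriangular id ∧ A = Q * T := by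
  obtain ⟨k, hk⟩ := Nat.exists_eq_add_of_le hR
  let f : Fin (R + k) → EuclideanSpace ℝ m := Fin.append (fun r => WithLp.toLp 2 (A.col r)) 0
  have hfinrank : Module.finrank ℝ (EuclideanSpace ℝ m) = Fintype.card (Fin (R + k)) := by
    simp [hk]
  let b := InnerProductSpace.gramSchmidtOrthonormalBasis hfinrank f
  have hb {r s : Fin (R + k)} (hsr : s < r) : inner ℝ (b r) (f s) = 0 :=
    InnerProductSpace.gramSchmidtOrthonormalBasis_inv_triangular hfinrank f hsr
  refine ⟨Matrix.of fun i r => b (Fin.castAdd k r) i,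
    Matrix.of fun r s => inner ℝ (b (Fin.castAdd k r)) (f (Fin.castAdd k s)),
    transpose_mul_self_eq_one_of_orthonormal
      (b.orthonormal.comp _ (Fin.castAdd_injective R k)),
    fun r s hsr => hb (show Fin.castAdd k s < Fin.castAdd k r from hsr), ?_⟩
  ext i s
  have hcol := congrArg (fun v => v i) (b.sum_repr' (f (Fin.castAdd k s)))
  have hrest (r : Fin k) : inner ℝ (b (Fin.natAdd R r)) (f (Fin.castAdd k s)) = 0 :=
    hb (by simp [Fin.lt_def]; omega)
  rw [Fin.sum_univ_add] at hcol
  simp only [hrest] at hcol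
  simpa [f, Matrix.mul_apply, mul_comm, eq_comm] using hcol

theorem exists_rq {n : Type*} [Fintype n] {R : ℕ} (hR : R ≤ Fintype.card n)
    (B : Matrix (Fin R) n ℝ) :
    ∃ (T : Matrix (Fin R) (Fin R) ℝ) (Q : Matrix n (Fin R) ℝ),
      T.BlockTriangular id ∧ Qᵀ * Q = 1 ∧ B = T * Qᵀ := by
  obtain ⟨Q, T, hQ, hT, hB⟩ := exists_qr hR (Bᵀ.submatrix id Fin.revPerm)
  refine ⟨(T.submatrix Fin.revPerm Fin.revPerm)ᵀ, Q.submatrix id Fin.revPerm,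
    fun i j hij => hT (by simpa using hij), ?_, ?_⟩
  · rw [Matrix.transpose_submatrix, ← Matrix.submatrix_mul _ _ _ _ _ Function.bijective_id, hQ,
      Matrix.submatrix_one_equiv]
  · rw [← Matrix.transpose_mul, Matrix.submatrix_mul_equiv, ← hB]
    ext i j
    simp

theorem exists_orthonormal_mul_eq_of_rank_le {m n : Type*} [Fintype m] [Fintype n] {R : ℕ}
    (hR : R ≤ Fintype.card m) {M : Matrix m n ℝ} (h : M.rank ≤ R) :
    ∃ (C : Matrix m (Fin R) ℝ) (V : Matrix (Fin R) n ℝ), Cᵀ * C = 1 ∧ M = C * V := by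
  obtain ⟨A, V, rfl⟩ := exists_mul_eq_of_rank_le h
  obtain ⟨Q, T, hQ, -, rfl⟩ := exists_qr hR A
  exact ⟨Q, T * V, hQ, Matrix.mul_assoc _ _ _⟩

end Factorization

section LowRank

open scoped Matrix.Norms.Frobenius
attribute [local instance] frobeniusInnerProductSpace

variable {m n p : Type*} [Fintype m] [Fintype n] [Fintype p]
  {M : Matrix m n ℝ} {Q : Matrix m p ℝ} {V : Matrix p n ℝ}

/-- The first-order conditions for `‖M - Q V‖²` to be minimal in `Q` and in `V`, together with the
second-order condition along the products `(Q + t u xᵀ) (V + t x wᵀ)` with `u` orthogonal to the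
columns of `Q`, optimized over `w`. -/
structure IsSecondOrderCritical (M : Matrix m n ℝ) (Q : Matrix m p ℝ) (V : Matrix p n ℝ) :
    Prop where
  transpose_mul_residual : Qᵀ * (M - Q * V) = 0
  residual_mul_transpose : (M - Q * V) * Vᵀ = 0
  second_order : ∀ (x : p → ℝ) (u : m → ℝ), Qᵀ *ᵥ u = 0 →
    (x ⬝ᵥ x) * ((u ᵥ* (M - Q * V)) ⬝ᵥ (u ᵥ* (M - Q * V))) ≤ (u ⬝ᵥ u) * ((x ᵥ* V) ⬝ᵥ (x ᵥ* V))

theorem frobenius_norm_sub_projection_comm [DecidableEq p] {C Q : Matrix m p ℝ}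
    (hC : Cᵀ * C = 1) (hQ : Qᵀ * Q = 1) :
    ‖C - Q * (Qᵀ * C)‖ ^ 2 = ‖Q - C * (Cᵀ * Q)‖ ^ 2 := by
  rw [frobenius_norm_sub_projection_sq hQ, frobenius_norm_sub_projection_sq hC,
    ← Matrix.frobenius_norm_transpose (Cᵀ * Q), Matrix.transpose_mul, Matrix.transpose_transpose,
    frobenius_norm_sq C, frobenius_norm_sq Q, hC, hQ]

namespace IsSecondOrderCritical

theorem norm_transpose_mul_sq_le {q r : Type*} [Fintype q] [Fintype r] {U : Matrix m q ℝ}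
    {W : Matrix r p ℝ} (h : IsSecondOrderCritical M Q V) (hQU : Qᵀ * U = 0)
    (hUW : ‖U‖ ^ 2 = ‖W‖ ^ 2) : ‖Uᵀ * (M - Q * V)‖ ^ 2 ≤ ‖W * V‖ ^ 2 := by
  have hprod : ‖W‖ ^ 2 * ‖Uᵀ * (M - Q * V)‖ ^ 2 ≤ ‖U‖ ^ 2 * ‖W * V‖ ^ 2 := by
    rw [← Matrix.frobenius_norm_transpose U]
    simp only [frobenius_norm_sq_eq_sum_dotProduct]
    rw [Finset.sum_mul_sum, Finset.sum_mul_sum, Finset.sum_comm]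
    refine Finset.sum_le_sum fun i _ => Finset.sum_le_sum fun j _ => h.second_order (W j) (Uᵀ i) ?_
    exact funext fun r => congrFun (congrFun hQU r) i
  rcases eq_or_ne U 0 with rfl | hU
  · simp
  · rw [← hUW] at hprod
    exact le_of_mul_le_mul_left hprod (by positivity)

theorem norm_residual_le [DecidableEq p] (h : IsSecondOrderCritical M Q V) (hQ : Qᵀ * Q = 1)
    {C : Matrix m p ℝ} (hC : Cᵀ * C = 1) : ‖M - Q * V‖ ^ 2 ≤ ‖M - C * (Cᵀ * M)‖ ^ 2 := by
  obtain ⟨Δ, hΔ⟩ : ∃ Δ, M = Q * V + Δ := ⟨M - Q * V, (add_sub_cancel _ _).symm⟩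
  have hres : M - Q * V = Δ := by rw [hΔ, add_sub_cancel_left]
  set W := Q - C * (Cᵀ * Q) with hW
  have hQU : Qᵀ * (C - Q * (Qᵀ * C)) = 0 := by
    rw [Matrix.mul_sub, ← Matrix.mul_assoc Qᵀ Q, hQ, Matrix.one_mul, sub_self]
  have hUΔ : (C - Q * (Qᵀ * C))ᵀ * Δ = Cᵀ * Δ := by
    rw [Matrix.transpose_sub, Matrix.transpose_mul, Matrix.sub_mul, Matrix.mul_assoc _ Qᵀ, ← hres,
      h.transpose_mul_residual, Matrix.mul_zero, sub_zero]
  have hle : ‖Cᵀ * Δ‖ ^ 2 ≤ ‖W * V‖ ^ 2 := by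
    have := h.norm_transpose_mul_sq_le hQU (frobenius_norm_sub_projection_comm hC hQ)
    rwa [hres, hUΔ] at this
  have hsplit : M - C * (Cᵀ * M) = (Δ - C * (Cᵀ * Δ)) + W * V := by
    rw [hΔ, hW, Matrix.sub_mul, Matrix.mul_add, Matrix.mul_add]
    simp only [Matrix.mul_assoc]
    abel
  have hcross : inner ℝ (Δ - C * (Cᵀ * Δ)) (W * V) = 0 := by
    rw [frobenius_inner_mul_right, Matrix.sub_mul, Matrix.mul_assoc C, Matrix.mul_assoc Cᵀ, ← hres,
      h.residual_mul_transpose]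
    simp
  rw [hres, hsplit, norm_add_sq_real, hcross, frobenius_norm_sub_projection_sq hC]
  linarith

theorem isNearestPoint {R : ℕ} (hR : R ≤ Fintype.card m) {Q : Matrix m (Fin R) ℝ}
    {V : Matrix (Fin R) n ℝ} (h : IsSecondOrderCritical M Q V) (hQ : Qᵀ * Q = 1) :
    IsNearestPoint {N : Matrix m n ℝ | N.rank ≤ R} M (Q * V) := by
  refine ⟨(Matrix.rank_mul_le_left Q V).trans (by simpa using Q.rank_le_card_width), fun N hN => ?_⟩
  obtain ⟨C, T, hC, rfl⟩ := exists_orthonormal_mul_eq_of_rank_le hR hN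
  rw [dist_eq_norm, dist_eq_norm, ← sq_le_sq₀ (norm_nonneg _) (norm_nonneg _),
    frobenius_norm_sub_mul_sq hC]
  exact (h.norm_residual_le hQ hC).trans (le_add_of_nonneg_right (sq_nonneg _))

end IsSecondOrderCritical

/-- The matrices `Q V` with `m` rows, where `V ∈ 𝒞` and `Q` is arbitrary. -/
def leftMultiples (m : Type*) (𝒞 : Set (Matrix p n ℝ)) : Set (Matrix m n ℝ) :=
  {N | ∃ (Q : Matrix m p ℝ), ∃ V ∈ 𝒞, Q * V = N}

/-- Every rank-one direction `x wᵀ` is tangent to `𝒞` at `V`, to second order. -/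
def RankOneTangent (𝒞 : Set (Matrix p n ℝ)) (V : Matrix p n ℝ) : Prop :=
  ∀ (x : p → ℝ) (w : n → ℝ), ∃ K : ℝ → Matrix p n ℝ, ContinuousAt K 0 ∧
    ∀ t, V + (t • Matrix.vecMulVec x w + t ^ 2 • K t) ∈ 𝒞

section Necessary

variable {𝒞 : Set (Matrix p n ℝ)}

omit [Fintype n] [Fintype p] in
theorem RankOneTangent.mem (h : RankOneTangent 𝒞 V) : V ∈ 𝒞 := by
  obtain ⟨K, -, hK⟩ := h 0 0
  simpa using hK 0

namespace IsNearestPoint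

theorem residual_mul_transpose_eq_zero (hV : V ∈ 𝒞)
    (h : IsNearestPoint (leftMultiples m 𝒞) M (Q * V)) : (M - Q * V) * Vᵀ = 0 := by
  have hinner : inner ℝ (M - Q * V) ((M - Q * V) * Vᵀ * V) = 0 := by
    refine h.inner_eq_zero (q := 0) continuousAt_const (.of_forall fun t => ?_)
    exact ⟨Q + t • ((M - Q * V) * Vᵀ), V, hV, by simp [Matrix.add_mul]⟩
  rwa [frobenius_inner_mul_right, inner_self_eq_zero] at hinner

theorem transpose_mul_residual_eq_zero (hV : RankOneTangent 𝒞 V)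
    (h : IsNearestPoint (leftMultiples m 𝒞) M (Q * V)) : Qᵀ * (M - Q * V) = 0 := by
  classical
  ext i j
  obtain ⟨K, hK, hmem⟩ := hV (Pi.single i 1) (Pi.single j 1)
  rw [← Matrix.single_eq_single_vecMulVec_single] at hmem
  have hinner : inner ℝ (M - Q * V) (Q * Matrix.single i j (1 : ℝ)) = 0 := by
    refine h.inner_eq_zero (q := fun t => Q * K t) (by fun_prop) (.of_forall fun t => ?_)
    exact ⟨Q, _, hmem t, by simp only [Matrix.mul_add, Matrix.mul_smul]⟩
  rwa [frobenius_inner_mul_left, frobenius_inner_single] at hinner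

theorem isSecondOrderCritical [DecidableEq p] (hV : RankOneTangent 𝒞 V) (hQ : Qᵀ * Q = 1)
    (h : IsNearestPoint (leftMultiples m 𝒞) M (Q * V)) :
    IsSecondOrderCritical M Q V := by
  have hQΔ := h.transpose_mul_residual_eq_zero hV
  refine ⟨hQΔ, h.residual_mul_transpose_eq_zero hV.mem, fun x u hu => ?_⟩
  set v := u ᵥ* (M - Q * V)
  set E := Matrix.vecMulVec u x with hE
  set F := Matrix.vecMulVec x v with hF
  obtain ⟨K, hK, hmem⟩ := hV x v
  have hle := h.two_mul_inner_le (p := E * V + Q * F)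
    (q := fun t => E * F + Q * K t + t • (E * K t)) (by fun_prop) <| .of_forall fun t =>
      ⟨Q + t • E, _, hmem t, by
        simp only [Matrix.mul_add, Matrix.add_mul, Matrix.smul_mul, Matrix.mul_smul, hF]
        module⟩
  have hEF : inner ℝ (M - Q * V) (E * F) = (x ⬝ᵥ x) * (v ⬝ᵥ v) := by
    rw [hE, hF, Matrix.vecMulVec_mul_vecMulVec, Matrix.vecMulVec_smul, inner_smul_right,
      frobenius_inner_vecMulVec, Matrix.dotProduct_mulVec]
  have hQK : inner ℝ (M - Q * V) (Q * K 0) = 0 := by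
    rw [frobenius_inner_mul_left, hQΔ, inner_zero_left]
  have hcross : inner ℝ (E * V) (Q * F) = 0 := by
    rw [frobenius_inner_mul_left, ← Matrix.mul_assoc, hE, Matrix.mul_vecMulVec, hu]
    simp
  have hEV : ‖E * V‖ ^ 2 = (u ⬝ᵥ u) * ((x ᵥ* V) ⬝ᵥ (x ᵥ* V)) := by
    rw [hE, Matrix.vecMulVec_mul, frobenius_norm_vecMulVec_sq]
  rw [norm_add_sq_real, hcross, hEV, frobenius_norm_mul_sq_of_transpose_mul_self_eq_one hQ, hF,
    frobenius_norm_vecMulVec_sq] at hle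
  simp only [zero_smul, add_zero, inner_add_right, hQK] at hle
  rw [hEF] at hle
  linarith

end IsNearestPoint

end Necessary

end LowRank

section Pencils

variable {κ m n p : Type*}

/-- The block row `[M₁ | M₂ | ⋯]`; the column index `(k, j)` stands for column `j` of `M k`. -/
def joinSlices (M : κ → Matrix m n ℝ) : Matrix m (κ × n) ℝ :=
  Matrix.of fun i q => M q.1 i q.2

theorem mul_joinSlices [Fintype p] (A : Matrix m p ℝ) (M : κ → Matrix p n ℝ) :
    A * joinSlices M = joinSlices fun k => A * M k := rfl

open scoped Matrix.Norms.Frobenius in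
attribute [local instance] frobeniusInnerProductSpace in
theorem frobenius_inner_joinSlices [Fintype κ] [Fintype m] [Fintype n] (M N : κ → Matrix m n ℝ) :
    inner ℝ (joinSlices M) (joinSlices N) = ∑ k, inner ℝ (M k) (N k) := by
  simp only [frobenius_inner_def, Matrix.trace, Matrix.diag, Matrix.mul_apply,
    Fintype.sum_prod_type, joinSlices, Matrix.of_apply, Matrix.transpose_apply]

/-- The block rows of the pencils that become upper triangular after multiplication by suitable
matrices on both sides; the multipliers `A` and `B` are not required to be orthogonal or
invertible. -/
def schurPencils (κ : Type*) (R : ℕ) : Set (Matrix (Fin R) (κ × Fin R) ℝ) :=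
  {N | ∃ (A B : Matrix (Fin R) (Fin R) ℝ) (T : κ → Matrix (Fin R) (Fin R) ℝ),
    (∀ k, (T k).BlockTriangular id) ∧ joinSlices (fun k => A * T k * B) = N}

theorem joinSlices_mem_schurPencils {R : ℕ} {U : κ → Matrix (Fin R) (Fin R) ℝ} (S : Set (Fin R))
    (hU : ∀ k i j, i ≠ j → U k i j ≠ 0 → i ∈ S ∧ j ∉ S) (A B : Matrix (Fin R) (Fin R) ℝ) :
    joinSlices (fun k => A * U k * B) ∈ schurPencils κ R := by
  classical
  set f : Fin R → ℕ := fun i => if i ∈ S then 0 else 1 with hf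
  -- Listing the indices in `S` first makes every `U k` upper triangular.
  set σ := Tuple.sort f
  refine ⟨A.submatrix id σ, B.submatrix σ id, fun k => (U k).submatrix σ σ,
    fun k i j hji => ?_, ?_⟩
  · by_contra hne
    obtain ⟨hi, hj⟩ := hU k (σ i) (σ j) (fun h => hji.ne' (σ.injective h)) hne
    have hmono : f (σ j) ≤ f (σ i) := Tuple.monotone_sort f hji.le
    simp [hf, hi, hj] at hmono
  · simp only [Matrix.submatrix_mul_equiv, Matrix.submatrix_id_id]

theorem exists_det_sum_smul_ne_zero {R : ℕ} {T : Fin 2 → Matrix (Fin R) (Fin R) ℝ}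
    (hT : ∀ k, (T k).BlockTriangular id) (hd : ∀ i, ∃ k, T k i i ≠ 0) :
    ∃ c : Fin 2 → ℝ, (∑ k, c k • T k).det ≠ 0 := by
  have hfin : (⋃ i : Fin R, {s : ℝ | T 0 i i + s * T 1 i i = 0}).Finite := by
    refine Set.finite_iUnion fun i => Set.Subsingleton.finite fun s hs t ht => ?_
    rw [Set.mem_ofPred_eq] at hs ht
    have hne : T 1 i i ≠ 0 := by
      intro h1
      obtain ⟨k, hk⟩ := hd i
      fin_cases k
      · exact hk (by simpa [h1] using hs)
      · exact hk h1
    exact mul_right_cancel₀ hne (by linarith)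
  obtain ⟨s, hs⟩ := hfin.exists_notMem
  refine ⟨![1, s], ?_⟩
  have htri : (∑ k, (![1, s] : Fin 2 → ℝ) k • T k).BlockTriangular id := by
    intro i j hij
    simp [Fin.sum_univ_two, hT _ hij]
  rw [Matrix.det_of_isUpperTriangular htri, Finset.prod_ne_zero_iff]
  intro i _ h0
  refine hs (Set.mem_iUnion.2 ⟨i, ?_⟩)
  simpa [Fin.sum_univ_two] using h0

section Diagonalizable

variable [Fintype p] [DecidableEq p]

theorem mul_diagonal_mul_apply (A : Matrix m p ℝ) (d : p → ℝ) (B : Matrix p n ℝ) (a : m) (b : n) :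
    (A * Matrix.diagonal d * B) a b = ∑ r, A a r * d r * B r b := by
  rw [Matrix.mul_apply]
  simp only [Matrix.mul_diagonal]

theorem isUnit_of_det_sum_smul_ne_zero [Fintype κ] {V : κ → Matrix p p ℝ} {c : κ → ℝ}
    (hc : (∑ k, c k • V k).det ≠ 0) {A B : Matrix p p ℝ} {d : κ → p → ℝ}
    (hV : ∀ k, V k = A * Matrix.diagonal (d k) * B) :
    IsUnit A ∧ IsUnit B ∧ ∀ i, ∃ k, d k i ≠ 0 := by
  have hsum : ∑ k, c k • V k = A * Matrix.diagonal (∑ k, c k • d k) * B := by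
    ext a b
    simp only [hV, Matrix.sum_apply, Matrix.smul_apply, mul_diagonal_mul_apply, Finset.sum_apply,
      Pi.smul_apply, smul_eq_mul, Finset.mul_sum, Finset.sum_mul]
    rw [Finset.sum_comm]
    exact Finset.sum_congr rfl fun r _ => Finset.sum_congr rfl fun k _ => by ring
  rw [hsum, Matrix.det_mul, Matrix.det_mul, Matrix.det_diagonal] at hc
  simp only [mul_ne_zero_iff, Finset.prod_ne_zero_iff] at hc
  obtain ⟨⟨hA, hd⟩, hB⟩ := hc
  refine ⟨(Matrix.isUnit_iff_isUnit_det _).2 hA.isUnit,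
    (Matrix.isUnit_iff_isUnit_det _).2 hB.isUnit, fun i => ?_⟩
  by_contra! h0
  exact hd i (Finset.mem_univ i) (by simp [h0])

theorem exists_rearrangement (A : Matrix m p ℝ) (B : Matrix p n ℝ) (d : κ → p → ℝ) (z : p → ℝ)
    {i j : p} (hij : i ≠ j) (hi : z i ≠ 0) {γ : ℝ} (hγ : ∀ k, d k i = γ * d k j) :
    ∃ (A' : Matrix m p ℝ) (B' : Matrix p n ℝ) (d' : κ → p → ℝ),
      (∀ k, A' * Matrix.diagonal (d' k) * B' = A * Matrix.diagonal (d k) * B) ∧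
      A' *ᵥ Function.update (Function.update z i 1) j 0 = A *ᵥ z := by
  refine ⟨A.updateCol i (fun a => z i * A a i + z j * A a j),
    (B.updateRow i ((γ / z i) • B i)).updateRow j (B j - (γ * z j / z i) • B i),
    fun k => Function.update (d k) i (d k j), fun k => ?_, ?_⟩
  · ext a b
    rw [mul_diagonal_mul_apply, mul_diagonal_mul_apply, ← sub_eq_zero, ← Finset.sum_sub_distrib,
      Fintype.sum_eq_add i j hij]
    · simp only [Matrix.updateCol_self, Matrix.updateCol_ne hij.symm, Matrix.updateRow_self,
        Matrix.updateRow_ne hij, Function.update_self, Function.update_of_ne hij.symm, hγ,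
        Pi.sub_apply, Pi.smul_apply, smul_eq_mul]
      field_simp
      ring
    · rintro r ⟨hri, hrj⟩
      simp [hri, hrj]
  · ext a
    simp only [Matrix.mulVec, dotProduct]
    rw [← sub_eq_zero, ← Finset.sum_sub_distrib, Fintype.sum_eq_add i j hij]
    · simp only [Matrix.updateCol_self, Matrix.updateCol_ne hij.symm, Function.update_self,
        Function.update_of_ne hij]
      ring
    · rintro r ⟨hri, hrj⟩
      simp [hri, hrj]

theorem exists_eq_mul_of_mul_eq_mul {a b : Fin 2 → ℝ} (hb : ∃ k, b k ≠ 0)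
    (h : a 0 * b 1 = a 1 * b 0) : ∃ γ : ℝ, ∀ k, a k = γ * b k := by
  obtain ⟨k, hk⟩ := hb
  refine ⟨a k / b k, fun l => ?_⟩
  rw [div_mul_eq_mul_div, eq_div_iff hk]
  fin_cases k <;> fin_cases l <;> simp <;> linarith

theorem exists_diagonalization_nonparallel {Y : Fin 2 → Matrix m n ℝ}
    (hY : ∀ (A : Matrix m p ℝ) (B : Matrix p n ℝ) (d : Fin 2 → p → ℝ),
      (∀ k, Y k = A * Matrix.diagonal (d k) * B) → ∀ i, ∃ k, d k i ≠ 0)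
    (A : Matrix m p ℝ) (B : Matrix p n ℝ) (d : Fin 2 → p → ℝ)
    (hd : ∀ k, Y k = A * Matrix.diagonal (d k) * B) (z : p → ℝ) :
    ∃ (A' : Matrix m p ℝ) (B' : Matrix p n ℝ) (d' : Fin 2 → p → ℝ) (z' : p → ℝ),
      (∀ k, Y k = A' * Matrix.diagonal (d' k) * B') ∧ A' *ᵥ z' = A *ᵥ z ∧
      (Function.support z').Pairwise fun i j => d' 0 i * d' 1 j ≠ d' 1 i * d' 0 j := by
  induction hs : (Function.support z).ncard using Nat.strong_induction_on
    generalizing A B d z with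
  | _ s ih =>
    by_cases hgood : (Function.support z).Pairwise fun i j => d 0 i * d 1 j ≠ d 1 i * d 0 j
    · exact ⟨A, B, d, z, hd, rfl, hgood⟩
    obtain ⟨i, hi, j, hj, hij, hpar⟩ : ∃ i ∈ Function.support z, ∃ j ∈ Function.support z,
        i ≠ j ∧ d 0 i * d 1 j = d 1 i * d 0 j := by
      simpa [Set.Pairwise, and_assoc] using hgood
    obtain ⟨γ, hγ⟩ := exists_eq_mul_of_mul_eq_mul (a := (d · i)) (hY A B d hd j) hpar
    obtain ⟨A', B', d', hd', hz'⟩ := exists_rearrangement A B d z hij hi hγ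
    set z' := Function.update (Function.update z i 1) j 0
    have hlt : (Function.support z').ncard < s := by
      rw [← hs]
      refine Set.ncard_lt_ncard ⟨fun r hr => ?_, fun hsub => hsub hj (by simp [z'])⟩
      have hrj : r ≠ j := by rintro rfl; simp [z'] at hr
      rcases eq_or_ne r i with rfl | hri
      · exact hi
      · simpa [z', hrj, hri] using hr
    rw [← hz']
    exact ih _ hlt A' B' d' (fun k => by rw [hd', hd]) z' rfl

theorem exists_commutator_correction (d : Fin 2 → p → ℝ) (N : Fin 2 → Matrix p p ℝ) :
    ∃ (F H : Matrix p p ℝ) (T : Fin 2 → Matrix p p ℝ),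
      (∀ k, F * Matrix.diagonal (d k) + T k + Matrix.diagonal (d k) * H = N k) ∧
      ∀ k i j, T k i j ≠ 0 → d 0 i * d 1 j = d 1 i * d 0 j ∧ N k i j ≠ 0 := by
  have hentry : ∀ i j, ∃ (f h : ℝ) (t : Fin 2 → ℝ),
      (∀ k, f * d k j + t k + d k i * h = N k i j) ∧
      ∀ k, t k ≠ 0 → d 0 i * d 1 j = d 1 i * d 0 j ∧ N k i j ≠ 0 := by
    intro i j
    by_cases hpar : d 0 i * d 1 j = d 1 i * d 0 j
    · exact ⟨0, 0, fun k => N k i j, by simp, fun k hk => ⟨hpar, hk⟩⟩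
    · have hdet : d 0 j * d 1 i - d 1 j * d 0 i ≠ 0 := fun h0 => hpar (by linarith)
      -- Cramer's rule for the two equations in `f` and `h`.
      refine ⟨(N 0 i j * d 1 i - N 1 i j * d 0 i) / (d 0 j * d 1 i - d 1 j * d 0 i),
        (d 0 j * N 1 i j - d 1 j * N 0 i j) / (d 0 j * d 1 i - d 1 j * d 0 i), 0,
        fun k => ?_, fun k hk => absurd rfl hk⟩
      rw [← sub_eq_zero]
      fin_cases k <;> simp <;> field_simp [hdet] <;> ring
  choose f h t hsum hne using hentry
  refine ⟨Matrix.of f, Matrix.of h, fun k => Matrix.of fun i j => t i j k, fun k => ?_,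
    fun k i j => hne i j k⟩
  ext i j
  simp [Matrix.mul_diagonal, Matrix.diagonal_mul, hsum]

end Diagonalizable

section Tangent

open scoped Matrix.Norms.Frobenius

variable {R : ℕ} {V : Fin 2 → Matrix (Fin R) (Fin R) ℝ} {A B : Matrix (Fin R) (Fin R) ℝ}
  {d : Fin 2 → Fin R → ℝ}

theorem exists_curve_mem_schurPencils (hB : IsUnit B)
    (hV : ∀ k, V k = A * Matrix.diagonal (d k) * B) {z : Fin R → ℝ}
    (hz : (Function.support z).Pairwise fun i j => d 0 i * d 1 j ≠ d 1 i * d 0 j)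
    (w : Fin 2 × Fin R → ℝ) :
    ∃ K : ℝ → Matrix (Fin R) (Fin 2 × Fin R) ℝ, ContinuousAt K 0 ∧ ∀ t,
      joinSlices V + (t • Matrix.vecMulVec (A *ᵥ z) w + t ^ 2 • K t) ∈ schurPencils (Fin 2) R := by
  set N : Fin 2 → Matrix (Fin R) (Fin R) ℝ :=
    fun k => Matrix.vecMulVec z ((fun j => w (k, j)) ᵥ* B⁻¹) with hN
  set D : Fin 2 → Matrix (Fin R) (Fin R) ℝ := fun k => Matrix.diagonal (d k) with hD
  have hNw : Matrix.vecMulVec (A *ᵥ z) w = joinSlices fun k => A * N k * B := by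
    ext i ⟨k, j⟩
    have hk : A * N k * B = Matrix.vecMulVec (A *ᵥ z) fun j => w (k, j) := by
      rw [hN, Matrix.mul_vecMulVec, Matrix.vecMulVec_mul, Matrix.vecMul_vecMul,
        Matrix.nonsing_inv_mul _ ((Matrix.isUnit_iff_isUnit_det _).1 hB), Matrix.vecMul_one]
    exact congrFun (congrFun hk.symm i) j
  obtain ⟨F, H, T, hT, hTne⟩ := exists_commutator_correction d N
  set K₀ := joinSlices fun k => A * (F * T k + F * D k * H + T k * H) * B with hK₀
  set K₁ := joinSlices fun k => A * (F * T k * H) * B with hK₁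
  refine ⟨fun t => K₀ + t • K₁, by fun_prop, fun t => ?_⟩
  have hcurve : joinSlices V + (t • Matrix.vecMulVec (A *ᵥ z) w + t ^ 2 • (K₀ + t • K₁)) =
      joinSlices fun k => A * (1 + t • F) * (D k + t • T k) * ((1 + t • H) * B) := by
    have hslice : ∀ k, V k + (t • (A * N k * B) + t ^ 2 • (A * (F * T k + F * D k * H + T k * H) * B
        + t • (A * (F * T k * H) * B))) =
        A * (1 + t • F) * (D k + t • T k) * ((1 + t • H) * B) := by
      intro k
      rw [hV, ← hT k]
      simp only [Matrix.mul_add, Matrix.add_mul, Matrix.mul_one, Matrix.one_mul, Matrix.smul_mul,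
        Matrix.mul_smul, smul_add, smul_smul, Matrix.mul_assoc]
      module
    rw [hNw, hK₀, hK₁, ← funext hslice]
    rfl
  rw [hcurve]
  refine joinSlices_mem_schurPencils (Function.support z) (fun k i j hij hne => ?_) _ _
  have hTij : T k i j ≠ 0 := fun h0 => hne (by simp [hD, Matrix.diagonal_apply_ne _ hij, h0])
  obtain ⟨hpar, hNij⟩ := hTne k i j hTij
  have hzi : z i ≠ 0 := fun h0 => hNij (by simp [hN, Matrix.vecMulVec_apply, h0])
  exact ⟨hzi, fun hzj => hz hzi hzj hij hpar⟩

theorem rankOneTangent_schurPencils {c : Fin 2 → ℝ} (hc : (∑ k, c k • V k).det ≠ 0)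
    (hV : ∀ k, V k = A * Matrix.diagonal (d k) * B) :
    RankOneTangent (schurPencils (Fin 2) R) (joinSlices V) := by
  intro x w
  have hA := (isUnit_of_det_sum_smul_ne_zero hc hV).1
  obtain ⟨A', B', d', z, hV', hz, hpair⟩ := exists_diagonalization_nonparallel
    (fun A B d h => (isUnit_of_det_sum_smul_ne_zero hc h).2.2) A B d hV (A⁻¹ *ᵥ x)
  have hx : A' *ᵥ z = x := by
    rw [hz, Matrix.mulVec_mulVec, Matrix.mul_nonsing_inv _ ((Matrix.isUnit_iff_isUnit_det _).1 hA),
      Matrix.one_mulVec]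
  rw [← hx]
  exact exists_curve_mem_schurPencils (isUnit_of_det_sum_smul_ne_zero hc hV').2.1 hV' hpair w

end Tangent

end Pencils

namespace ThreeWay

section Rank

variable {I J K R : ℕ} {Y : ThreeWay I J K}

theorem rank_le_card {ι : Type*} [Fintype ι] (a : ι → Fin I → ℝ) (b : ι → Fin J → ℝ)
    (c : ι → Fin K → ℝ) (h : ∀ i j k, Y i j k = ∑ r, a r i * b r j * c r k) :
    rank Y ≤ Fintype.card ι := by
  classical
  -- The definition of rank-one arrays forces the zero terms to be discarded.
  set s : Finset ι := {r | a r ≠ 0 ∧ b r ≠ 0 ∧ c r ≠ 0} with hs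
  have hne : ∀ r : Fin s.card, a (s.equivFin.symm r) ≠ 0 ∧ b (s.equivFin.symm r) ≠ 0 ∧
      c (s.equivFin.symm r) ≠ 0 := fun r => (Finset.mem_filter.1 (s.equivFin.symm r).2).2
  refine le_trans (Nat.sInf_le ⟨fun r i j k => a (s.equivFin.symm r) i * b (s.equivFin.symm r) j *
    c (s.equivFin.symm r) k, fun r => ⟨_, _, _, (hne r).1, (hne r).2.1, (hne r).2.2,
      fun _ _ _ => rfl⟩, ?_⟩) s.card_le_univ
  funext i j k
  rw [h, Finset.sum_apply, Finset.sum_apply, Finset.sum_apply,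
    s.equivFin.symm.sum_comp fun r : s => a r i * b r j * c r k,
    s.sum_coe_sort fun r => a r i * b r j * c r k]
  refine (Finset.sum_subset s.subset_univ fun r _ hr => ?_).symm
  simp only [hs, Finset.mem_filter, Finset.mem_univ, true_and, not_and_or, not_not] at hr
  rcases hr with hr | hr | hr <;> simp [hr]

theorem rank_le_iff_exists_slice_eq_mul_diagonal_mul :
    rank Y ≤ R ↔ ∃ (A : Matrix (Fin I) (Fin R) ℝ) (d : Fin K → Fin R → ℝ)
      (B : Matrix (Fin R) (Fin J) ℝ), ∀ k, Y.slice k = A * Matrix.diagonal (d k) * B := by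
  constructor
  · intro h
    obtain ⟨S, hS, hsum⟩ := isSumOfRankOnes_rank Y
    choose a b c _ _ _ habc using hS
    have hinj := Fin.castLE_injective h
    refine ⟨Matrix.of fun i r => Function.extend (Fin.castLE h) a 0 r i,
      fun k r => Function.extend (Fin.castLE h) c 0 r k,
      Matrix.of (Function.extend (Fin.castLE h) b 0), fun k => ?_⟩
    ext i j
    have hY : Y i j k = ∑ r, S r i j k := by
      simpa only [Finset.sum_apply] using congrFun (congrFun (congrFun hsum i) j) k
    rw [mul_diagonal_mul_apply]
    refine hY.trans (Fintype.sum_of_injective _ hinj _ _ (fun r hr => ?_) fun r => ?_)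
    · simp [Function.extend_apply' _ _ _ hr]
    · simp [hinj.extend_apply, habc, mul_right_comm]
  · rintro ⟨A, d, B, h⟩
    simpa using rank_le_card (fun r i => A i r) B (fun r k => d k r) fun i j k => by
      simpa only [slice, Matrix.of_apply, mul_diagonal_mul_apply, mul_right_comm] using
        congrFun (congrFun (h k) i) j

theorem rank_ofSlices_mul_le {P Q : ℕ} (T : Fin K → Matrix (Fin P) (Fin Q) ℝ)
    (A : Matrix (Fin I) (Fin P) ℝ) (B : Matrix (Fin Q) (Fin J) ℝ) :
    rank (ofSlices fun k => A * T k * B) ≤ rank (ofSlices T) := by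
  obtain ⟨A', d, B', h⟩ :=
    rank_le_iff_exists_slice_eq_mul_diagonal_mul.1 (le_refl (rank (ofSlices T)))
  refine rank_le_iff_exists_slice_eq_mul_diagonal_mul.2 ⟨A * A', d, B' * B, fun k => ?_⟩
  have hT : T k = A' * Matrix.diagonal (d k) * B' := h k
  change A * T k * B = _
  simp only [hT, Matrix.mul_assoc]

end Rank

section Unfold

open scoped Matrix.Norms.Frobenius
attribute [local instance] frobeniusInnerProductSpace

variable {I J K R : ℕ}

/-- The block row of the frontal slices of an array; the Frobenius norm of arrays is the norm of
this matrix. -/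
def unfold : ThreeWay I J K ≃ₗ[ℝ] Matrix (Fin I) (Fin K × Fin J) ℝ where
  toFun Y := joinSlices Y.slice
  invFun M i j k := M i (k, j)
  map_add' _ _ := rfl
  map_smul' _ _ := rfl

theorem unfold_apply (Y : ThreeWay I J K) : unfold Y = joinSlices Y.slice := rfl

theorem frobSq_eq_norm_unfold_sq (Y : ThreeWay I J K) : frobSq Y = ‖unfold Y‖ ^ 2 := by
  rw [frobenius_norm_sq_eq_sum_dotProduct, frobSq]
  refine Finset.sum_congr rfl fun i _ => ?_
  rw [dotProduct, Fintype.sum_prod_type, Finset.sum_comm]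
  simp only [sq]
  rfl

theorem frobSq_sub_le_iff {X Y Z : ThreeWay I J K} :
    frobSq (Z - X) ≤ frobSq (Z - Y) ↔ dist (unfold Z) (unfold X) ≤ dist (unfold Z) (unfold Y) := by
  rw [frobSq_eq_norm_unfold_sq, frobSq_eq_norm_unfold_sq, map_sub, map_sub, dist_eq_norm,
    dist_eq_norm, sq_le_sq₀ (norm_nonneg _) (norm_nonneg _)]

theorem mem_W_iff {Y : ThreeWay I J 2} : Y ∈ W I J R ↔ (unfold Y).rank ≤ R := by
  have hcols : Matrix.fromCols (Y.slice 0) (Y.slice 1) = (unfold Y).submatrix (Equiv.refl _)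
      ((finTwoEquiv.prodCongr (Equiv.refl _)).trans (Equiv.boolProdEquivSum _)).symm := by
    ext i (j | j) <;> rfl
  rw [W, Set.mem_ofPred_eq, hcols, Matrix.rank_submatrix]

theorem isBestFromW_iff {Z X : ThreeWay I J 2} :
    IsBestFromW R Z X ↔ IsNearestPoint {N | N.rank ≤ R} (unfold Z) (unfold X) := by
  simp only [IsBestFromW, IsNearestPoint, frobSq_sub_le_iff, mem_W_iff, Set.mem_ofPred_eq,
    unfold.surjective.forall]

theorem isAddHaarMeasure_volume : (volume : Measure (ThreeWay I J K)).IsAddHaarMeasure :=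
  have : (volume : Measure (Fin J → Fin K → ℝ)).IsAddHaarMeasure :=
    Measure.pi.isAddHaarMeasure fun _ => volume
  Measure.pi.isAddHaarMeasure fun _ => volume

theorem ae_existsUnique_isBestFromW :
    ∀ᵐ Z : ThreeWay I J 2, ∃! X, IsBestFromW R Z X := by
  have := isAddHaarMeasure_volume (I := I) (J := J) (K := 2)
  have hne : {N : Matrix (Fin I) (Fin 2 × Fin J) ℝ | N.rank ≤ R}.Nonempty := ⟨0, by simp⟩
  filter_upwards [ae_existsUnique_isNearestPoint_map volume unfold (isClosed_setOf_rank_le R) hne]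
    with Z hZ
  simpa only [isBestFromW_iff] using
    (unfold.bijective.existsUnique_iff (p := IsNearestPoint _ (unfold Z))).1 hZ

end Unfold

end ThreeWay

namespace GSD

section Optimal

open scoped Matrix.Norms.Frobenius
attribute [local instance] frobeniusInnerProductSpace

open ThreeWay

variable {I J R : ℕ}

theorem unfold_toArray (G : GSD I J R) :
    unfold G.toArray = G.Qa * joinSlices fun k => G.Rm k * G.Qbᵀ := by
  simp only [mul_joinSlices, ← Matrix.mul_assoc]
  rfl

theorem Feasible.inner_unfold_sub {G : GSD I J R} (hG : G.Feasible) (Z : ThreeWay I J 2)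
    (N : Fin 2 → Matrix (Fin R) (Fin R) ℝ) :
    inner ℝ (unfold Z - unfold G.toArray) (joinSlices fun k => G.Qa * N k * G.Qbᵀ) =
      ∑ k, inner ℝ (G.Qaᵀ * Z.slice k * G.Qb - G.Rm k) (N k) := by
  obtain ⟨hQa, hQb, -⟩ := hG
  have hslice : ∀ k, G.Qaᵀ * (Z.slice k - G.Qa * G.Rm k * G.Qbᵀ) * G.Qb =
      G.Qaᵀ * Z.slice k * G.Qb - G.Rm k := by
    intro k
    rw [Matrix.mul_sub, Matrix.sub_mul]
    congr 1
    calc G.Qaᵀ * (G.Qa * G.Rm k * G.Qbᵀ) * G.Qb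
        = (G.Qaᵀ * G.Qa) * G.Rm k * (G.Qbᵀ * G.Qb) := by simp only [Matrix.mul_assoc]
      _ = G.Rm k := by rw [hQa, hQb, Matrix.one_mul, Matrix.mul_one]
  rw [← map_sub, unfold_apply, frobenius_inner_joinSlices]
  refine Finset.sum_congr rfl fun k _ => ?_
  rw [frobenius_inner_mul_right, frobenius_inner_mul_left, Matrix.transpose_transpose,
    ← Matrix.mul_assoc, ← hslice]
  rfl

theorem IsOptimal.inner_unfold_sub_eq_zero {Z : ThreeWay I J 2} {G : GSD I J R}
    (hG : G.IsOptimal Z) {N : Fin 2 → Matrix (Fin R) (Fin R) ℝ}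
    (hN : ∀ k, (N k).BlockTriangular id) :
    inner ℝ (unfold Z - unfold G.toArray) (joinSlices fun k => G.Qa * N k * G.Qbᵀ) = 0 := by
  obtain ⟨⟨hQa, hQb, hRm⟩, hmin⟩ := hG
  have hnear : IsNearestPoint {M | ∃ G : GSD I J R, G.Feasible ∧ unfold G.toArray = M}
      (unfold Z) (unfold G.toArray) := by
    refine ⟨⟨G, ⟨hQa, hQb, hRm⟩, rfl⟩, ?_⟩
    rintro _ ⟨G', hG', rfl⟩
    exact frobSq_sub_le_iff.1 (hmin G' hG')
  refine hnear.inner_eq_zero (q := 0) continuousAt_const (.of_forall fun t => ?_)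
  refine ⟨⟨G.Qa, G.Qb, fun l => G.Rm l + t • N l⟩, ⟨hQa, hQb, fun l => (hRm l).add ?_⟩, ?_⟩
  · intro a b hba
    rw [Matrix.smul_apply, hN l hba, smul_zero]
  · simp only [unfold_toArray, mul_joinSlices, Matrix.mul_assoc, Matrix.add_mul, Matrix.mul_add,
      Matrix.smul_mul, Matrix.mul_smul, Pi.zero_apply, smul_zero, add_zero]
    rfl

theorem IsOptimal.transpose_mul_slice_mul_apply {Z : ThreeWay I J 2} {G : GSD I J R}
    (hG : G.IsOptimal Z) (k : Fin 2) {i j : Fin R} (hij : i ≤ j) :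
    (G.Qaᵀ * Z.slice k * G.Qb) i j = G.Rm k i j := by
  set N : Fin 2 → Matrix (Fin R) (Fin R) ℝ := Pi.single k (Matrix.single i j 1) with hN
  have htri : ∀ l, (N l).BlockTriangular id := by
    intro l
    rcases eq_or_ne l k with rfl | hl
    · simpa [hN] using Matrix.blockTriangular_single (b := id) hij (1 : ℝ)
    · simp [hN, hl, Matrix.blockTriangular_zero]
  have hinner := hG.inner_unfold_sub_eq_zero htri
  rw [hG.1.inner_unfold_sub, Fintype.sum_eq_single k fun l hl => by simp [hN, hl], hN,
    Pi.single_eq_same, frobenius_inner_single, Matrix.sub_apply, sub_eq_zero] at hinner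
  exact hinner

theorem StrictSecondOrder.tildeSq_pos (hR : 2 ≤ R) {Z : ThreeWay I J 2} {G : GSD I J R}
    (h : G.StrictSecondOrder Z) (i : Fin R) : 0 < G.tildeSq Z i i := by
  have hnonneg : ∀ a b, 0 ≤ G.tildeSq Z a b := fun a b => Finset.sum_nonneg fun k _ => sq_nonneg _
  have := Fin.nontrivial_iff_two_le.2 hR
  by_cases hi : IsMax i
  · have hcov := Order.pred_covBy_of_not_isMin hi.not_isMin
    have hIoc : Finset.Ioc (Order.pred i) i = {i} :=
      Finset.coe_injective (by simpa using hcov.Ioc_eq)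
    have hpos := (h _ _ hcov.lt).2
    rw [hIoc, Finset.sum_singleton, Finset.sum_singleton] at hpos
    linarith [hnonneg i (Order.pred i)]
  · have hcov := Order.covBy_succ_of_not_isMax hi
    have hIco : Finset.Ico i (Order.succ i) = {i} :=
      Finset.coe_injective (by simpa using hcov.Ico_eq)
    have hpos := (h _ _ hcov.lt).1
    rw [hIco, Finset.sum_singleton, Finset.sum_singleton] at hpos
    linarith [hnonneg (Order.succ i) i]

namespace IsOptimal

theorem exists_diag_ne_zero (hR : 2 ≤ R) {Z : ThreeWay I J 2} {G : GSD I J R} (hG : G.IsOptimal Z)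
    (h : G.StrictSecondOrder Z) (i : Fin R) : ∃ k, G.Rm k i i ≠ 0 := by
  by_contra! h0
  have hpos := h.tildeSq_pos hR i
  simp [tildeSq, hG.transpose_mul_slice_mul_apply, h0] at hpos

variable {Z : ThreeWay I R 2} {G : GSD I R R}

theorem isNearestPoint (hRI : R ≤ I) (hG : G.IsOptimal Z) :
    IsNearestPoint (leftMultiples (Fin I) (schurPencils (Fin 2) R)) (unfold Z)
      (G.Qa * joinSlices fun k => G.Rm k * G.Qbᵀ) := by
  refine ⟨⟨G.Qa, _, ⟨1, G.Qbᵀ, G.Rm, hG.1.2.2, by simp only [Matrix.one_mul]⟩, rfl⟩, ?_⟩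
  rintro _ ⟨P, _, ⟨A, B, T, hT, rfl⟩, rfl⟩
  obtain ⟨Qa, S, hQa, hS, hPA⟩ := exists_qr (hRI.trans_eq (Fintype.card_fin I).symm) (P * A)
  obtain ⟨S', Qb, hS', hQb, hB⟩ := exists_rq (Fintype.card_fin R).ge B
  set G' : GSD I R R := ⟨Qa, Qb, fun k => S * T k * S'⟩
  have hG' : unfold G'.toArray = P * joinSlices fun k => A * T k * B := by
    rw [unfold_toArray, mul_joinSlices, mul_joinSlices]
    congr 1
    funext k
    calc Qa * (S * T k * S' * Qbᵀ) = (Qa * S) * T k * (S' * Qbᵀ) := by simp only [Matrix.mul_assoc]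
      _ = P * (A * T k * B) := by rw [← hPA, ← hB]; simp only [Matrix.mul_assoc]
  rw [← unfold_toArray, ← hG']
  exact frobSq_sub_le_iff.1 (hG.2 G' ⟨hQa, hQb, fun k => (hS.mul (hT k)).mul hS'⟩)

theorem isBestFromW (hRI : R ≤ I) (hG : G.IsOptimal Z) (hdiag : ∀ i, ∃ k, G.Rm k i i ≠ 0)
    (hrank : rank (ofSlices G.Rm) ≤ R) : IsBestFromW R Z G.toArray := by
  obtain ⟨hQa, hQb, htri⟩ := hG.1
  obtain ⟨c, hc⟩ := exists_det_sum_smul_ne_zero htri hdiag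
  obtain ⟨A, d, B, hRm⟩ := rank_le_iff_exists_slice_eq_mul_diagonal_mul.1 hrank
  have hdet : (∑ k, c k • (G.Rm k * G.Qbᵀ)).det ≠ 0 := by
    simp only [← Matrix.smul_mul, ← Matrix.sum_mul]
    rw [Matrix.det_mul]
    exact mul_ne_zero hc (Matrix.isUnit_det_of_right_inverse hQb).ne_zero
  have hV : ∀ k, G.Rm k * G.Qbᵀ = A * Matrix.diagonal (d k) * (B * G.Qbᵀ) := fun k => by
    rw [← Matrix.mul_assoc, ← hRm]
    rfl
  have hcrit := (hG.isNearestPoint hRI).isSecondOrderCritical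
    (rankOneTangent_schurPencils hdet hV) hQa
  rw [isBestFromW_iff, unfold_toArray]
  exact hcrit.isNearestPoint (hRI.trans_eq (Fintype.card_fin I).symm) hQa

end IsOptimal

end Optimal

end GSD

theorem theorem5p1_general (I R : ℕ) (hRI : R ≤ I) :
    ∀ᵐ Z : ThreeWay I R 2, (∃! X : ThreeWay I R 2, ThreeWay.IsBestFromW R Z X) ∧
      ∀ X : ThreeWay I R 2, ThreeWay.IsBestFromW R Z X →
        ∀ G : GSD I R R, G.IsOptimal Z → (∀ i, ∃ k, G.Rm k i i ≠ 0) →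
          R < ThreeWay.rank X → R < ThreeWay.rank (ThreeWay.ofSlices G.Rm) := by
  filter_upwards [ThreeWay.ae_existsUnique_isBestFromW] with Z hZ
  refine ⟨hZ, fun X hX G hG hdiag hXrank => ?_⟩
  by_contra! hrank
  have hXG : X = G.toArray := hZ.unique hX (hG.isBestFromW hRI hdiag hrank)
  have hle : ThreeWay.rank G.toArray ≤ ThreeWay.rank (ThreeWay.ofSlices G.Rm) :=
    ThreeWay.rank_ofSlices_mul_le G.Rm G.Qa G.Qbᵀ
  exact hXrank.not_ge (hXG ▸ hle.trans hrank)

theorem theorem5p1 (I J R : ℕ) (hR : 2 ≤ R) (hJR : J = R) (hIJ : J < I) :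
    ∀ᵐ Z : ThreeWay I J 2 ∂(volume : Measure (ThreeWay I J 2)),
      (∃! X : ThreeWay I J 2, ThreeWay.IsBestFromW R Z X) ∧
      ∀ X : ThreeWay I J 2, ThreeWay.IsBestFromW R Z X →
        ∀ G : GSD I J R, GSD.IsOptimal Z G → GSD.StrictSecondOrder Z G →
          R < ThreeWay.rank X → R < ThreeWay.rank (ThreeWay.ofSlices G.Rm) := by
  subst hJR
  filter_upwards [theorem5p1_general I J hIJ.le] with Z ⟨hZ, hrank⟩
  exact ⟨hZ, fun X hX G hG hs => hrank X hX G hG (hG.exists_diag_ne_zero hR hs)⟩
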